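/- Zero-confirmation double spending. Let $n\ge 1$ be an integer, $0<p_{dc}\le 1$ and $p,f\in\mathbb R$ ($p_{dc}$ is the probability of a natural loss of connection, $p$ the seller's profit ratio, $f$ the fraction of customers not willing to wait for a confirmation). Consider the following two-player zero-sum concurrent stochastic game on the states $\{0,1,\dots,n\}$, played by the seller (Player 1) and a malicious buyer (Player 2). State $0$ is the shuffling state; state $s\ge 1$ stands for the double-spending success probability $p_s=0.1+\frac{0.4\,(s-1)}{n}$. *Actions.* In state $0$ each player has a single action. In a state $s\ge 1$ the seller chooses whether to reconnect to the network and whether to wait for a confirmation (four actions), and simultaneously the buyer chooses an amount $d\in\{1,\dots,20\}$ to double-spend. Put $p_a=0$ if the seller waits for a confirmation and $p_a=p_s$ otherwise. *Transitions.* From state $0$ the next state is uniform on $\{1,\dots,n\}$. From $s\ge 1$, if the seller reconnects, the next state is $0$. Otherwise, with probability $p_a$ the attack succeeds and the next state is $n$; with probability $(1-p_a)p_{dc}$ the attack fails and the next state is $0$; and with probability $(1-p_a)(1-p_{dc})$ the attack fails and the next state is uniform on $\{s-1,s,s+1\}\cap\{1,\dots,n\}$. *Rewards (profit of the seller).* The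 reward is $0$ in state $0$; in $s\ge 1$ it is $d\,p\,(1-p_a)-d\,(1-p)\,p_a+r$, where $r=10p(1-f)$ if the seller waits for a confirmation and $r=10p$ otherwise. A strategy maps each finite history of past states and action pairs, together with the current state, to a probability distribution on the actions available at the current state; $\mathbb E_s^{\sigma_1,\sigma_2}$ is the expectation over plays from $s$ under the strategies $\sigma_1,\sigma_2$ of the two players. For a play let $\mathrm{LimInfAvg}$ and $\mathrm{LimSupAvg}$ be the lower and upper limits of the average reward over the first $T$ rounds as $T\to\infty$. The game has value $v$ at $s$ if $$\sup_{\sigma_1}\inf_{\sigma_2}\mathbb E_s^{\sigma_1,\sigma_2}[\mathrm{LimInfAvg}]=v=\inf_{\sigma_2}\sup_{\sigma_1}\mathbb E_s^{\sigma_1,\sigma_2}[\mathrm{LimSupAvg}].$$ Then: 1. The game is ergodic: for all states $s,t$ and all strategies $\sigma_1,\sigma_2$, a play from $s$ almost surely visits $t$ infinitely often. 2. There is a real number $v$ that is the value of the game at every state. 3. The seller can ensure an average profit per round of at least $v$: there is a strategy $\sigma_1$ of the seller such that $\mathbb E_s^{\sigma_1,\sigma_2}[\mathrm{LimInfAvg}]\ge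 v$ for every initial state $s$ and every strategy $\sigma_2$ of the buyer. -/

import Mathlib

open MeasureTheory ProbabilityTheory Filter

/-- A concurrent stochastic game structure on the state space `S`, together with a real reward
function. Player 1 has action alphabet `A`, Player 2 has action alphabet `B`; at a state `s` the
players simultaneously pick moves in the non-empty sets `mov₁ s`, `mov₂ s`. The values of `trans`
and `reward` at unavailable moves are irrelevant, since strategies never use such moves. -/
structure ConcurrentGame (S A B : Type*) where
  /-- moves available to Player 1 -/
  mov₁ : S → Set A
  /-- moves available to Player 2 -/
  mov₂ : S → Set B
  mov₁_nonempty : ∀ s, (mov₁ s).Nonempty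
  mov₂_nonempty : ∀ s, (mov₂ s).Nonempty
  /-- the distribution of the successor state -/
  trans : S → A → B → PMF S
  /-- the reward collected by Player 1 -/
  reward : S → A → B → ℝ

namespace ConcurrentGame

section

variable {S A B : Type*}

/-- Strategies of Player 1: a history (the list of past states and action pairs, oldest first) and
the current state are mapped to a distribution over the moves available at the current state. -/
structure Strategy₁ (G : ConcurrentGame S A B) where
  choice : List (S × A × B) → S → PMF A
  support_subset : ∀ x s, (choice x s).support ⊆ G.mov₁ s

/-- Strategies of Player 2. -/
structure Strategy₂ (G : ConcurrentGame S A B) where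
  choice : List (S × A × B) → S → PMF B
  support_subset : ∀ x s, (choice x s).support ⊆ G.mov₂ s

variable (G : ConcurrentGame S A B)

/-- One round, after the history `x` and at the current state `s`: both players choose their moves
independently of each other. -/
noncomputable def round (σ₁ : G.Strategy₁) (σ₂ : G.Strategy₂) (x : List (S × A × B)) (s : S) :
    PMF (S × A × B) :=
  (σ₁.choice x s).bind fun a => (σ₂.choice x s).map fun b => (s, a, b)

/-- The round after a non-empty history, given as the history `x` of the earlier rounds and the
last round `y`: the successor state is drawn first, then the round is played there. -/
noncomputable def nextRound (σ₁ : G.Strategy₁) (σ₂ : G.Strategy₂) (x : List (S × A × B))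
    (y : S × A × B) : PMF (S × A × B) :=
  (G.trans y.1 y.2.1 y.2.2).bind fun t => G.round σ₁ σ₂ (x ++ [y]) t

variable [MeasurableSpace S] [MeasurableSpace A] [MeasurableSpace B]
  [Countable S] [Countable A] [Countable B]
  [MeasurableSingletonClass S] [MeasurableSingletonClass A] [MeasurableSingletonClass B]

/-- The conditional law of round `k + 1` given the rounds `0, …, k`. -/
noncomputable def stepKernel (σ₁ : G.Strategy₁) (σ₂ : G.Strategy₂) (k : ℕ) :
    Kernel (Π _ : Finset.Iic k, S × A × B) (S × A × B) :=
  Kernel.ofFunOfCountable fun h =>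
    (G.nextRound σ₁ σ₂
      (List.ofFn fun i : Fin k => h ⟨i, Finset.mem_Iic.2 i.2.le⟩)
      (h ⟨k, Finset.mem_Iic.2 le_rfl⟩)).toMeasure

instance (σ₁ : G.Strategy₁) (σ₂ : G.Strategy₂) (k : ℕ) :
    IsMarkovKernel (G.stepKernel σ₁ σ₂ k) :=
  ⟨fun _ => PMF.toMeasure.isProbabilityMeasure _⟩

/-- The law of the play (the infinite sequence of states and action pairs) that starts at `s`,
when the players use the strategies `σ₁` and `σ₂`. -/
noncomputable def playMeasure (σ₁ : G.Strategy₁) (σ₂ : G.Strategy₂) (s : S) :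
    Measure (ℕ → S × A × B) :=
  Kernel.trajMeasure (X := fun _ => S × A × B) (G.round σ₁ σ₂ [] s).toMeasure
    (G.stepKernel σ₁ σ₂)

/-- The average reward of a play over its first `T` rounds. -/
noncomputable def avg (T : ℕ) (ω : ℕ → S × A × B) : ℝ :=
  (1 / (T : ℝ)) * ∑ i ∈ Finset.range T, G.reward (ω i).1 (ω i).2.1 (ω i).2.2

/-- The limit-inferior average. (The rewards of a finite game are bounded, hence so are the
averages.) -/
noncomputable def limInfAvg (ω : ℕ → S × A × B) : ℝ :=
  liminf (fun T => G.avg T ω) atTop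

/-- The limit-superior average. -/
noncomputable def limSupAvg (ω : ℕ → S × A × B) : ℝ :=
  limsup (fun T => G.avg T ω) atTop

/-- The lower value `sup_{σ₁} inf_{σ₂} E[LimInfAvg]`. -/
noncomputable def lowerValue (s : S) : ℝ :=
  ⨆ σ₁ : G.Strategy₁, ⨅ σ₂ : G.Strategy₂, ∫ ω, G.limInfAvg ω ∂(G.playMeasure σ₁ σ₂ s)

/-- The upper value `inf_{σ₂} sup_{σ₁} E[LimSupAvg]`. -/
noncomputable def upperValue (s : S) : ℝ :=
  ⨅ σ₂ : G.Strategy₂, ⨆ σ₁ : G.Strategy₁, ∫ ω, G.limSupAvg ω ∂(G.playMeasure σ₁ σ₂ s)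

/-- `v` is the value of the game at `s`: lower and upper value are both equal to `v`. -/
def IsValue (s : S) (v : ℝ) : Prop :=
  G.lowerValue s = v ∧ G.upperValue s = v

/-- Ergodicity: whatever the strategies and the initial state, every state is almost surely visited
infinitely often. -/
def Ergodic : Prop :=
  ∀ (s t : S) (σ₁ : G.Strategy₁) (σ₂ : G.Strategy₂),
    ∀ᵐ ω ∂(G.playMeasure σ₁ σ₂ s), ∃ᶠ k in atTop, (ω k).1 = t

end

end ConcurrentGame

/-! ### The zero-confirmation double-spending game

The states are `0, 1, …, n`, where `0` is the shuffling state. The seller's actions are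
`0, 1, 2, 3 : Fin 4`, where `1` and `3` reconnect to the network, and `2` and `3` wait for a
confirmation. The buyer's action `d : Fin 21` is an attempt to double-spend `d` units. -/

namespace DoubleSpending

/-- The success probability of a double-spending attack associated with the state `s ≠ 0`. -/
noncomputable def successProb (n : ℕ) (s : Fin (n + 1)) : ℝ :=
  0.1 + (((s : ℕ) : ℝ) - 1) * 0.4 / n

/-- The seller's action `a` reconnects to the network. -/
def Reconnects (a : Fin 4) : Prop := a = 1 ∨ a = 3

/-- The seller's action `a` waits for a confirmation. -/
def Confirms (a : Fin 4) : Prop := a = 2 ∨ a = 3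

instance : DecidablePred Reconnects := fun a => inferInstanceAs (Decidable (a = 1 ∨ a = 3))

instance : DecidablePred Confirms := fun a => inferInstanceAs (Decidable (a = 2 ∨ a = 3))

/-- The success probability of an attack at the state `s ≠ 0` under the seller's action `a`. -/
noncomputable def attackProb (n : ℕ) (s : Fin (n + 1)) (a : Fin 4) : ℝ :=
  if Confirms a then 0 else successProb n s

/-- The non-shuffling states among `s - 1`, `s`, `s + 1`. -/
def nbhd (n : ℕ) (s : Fin (n + 1)) : Finset (Fin (n + 1)) :=
  {t | t ≠ 0 ∧ (s : ℕ) ≤ (t : ℕ) + 1 ∧ (t : ℕ) ≤ (s : ℕ) + 1}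

/-- Transition probabilities in case of a successful attack. -/
noncomputable def transSucc (n : ℕ) (s : Fin (n + 1)) (a : Fin 4) (t : Fin (n + 1)) : ℝ :=
  if t = Fin.last n then attackProb n s a else 0

/-- Transition probabilities in case of a failed attack; `pdc` is the probability of a natural
loss of connection. -/
noncomputable def transFail (n : ℕ) (pdc : ℝ) (s : Fin (n + 1)) (a : Fin 4) (t : Fin (n + 1)) : ℝ :=
  if t = 0 then pdc * (1 - attackProb n s a)
  else if t ∈ nbhd n s then (1 - attackProb n s a) / (nbhd n s).card * (1 - pdc)
  else 0

/-- The probability of moving from `s` to `t` under the seller's action `a` (the buyer's action has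
no influence on the transitions). -/
noncomputable def transProb (n : ℕ) (pdc : ℝ) (s : Fin (n + 1)) (a : Fin 4) (t : Fin (n + 1)) : ℝ :=
  if s = 0 then (if t = 0 then 0 else 1 / n)
  else if Reconnects a then (if t = 0 then 1 else 0)
  else transSucc n s a t + transFail n pdc s a t

/-- The expected profit of the seller from the malicious buyer at `s ≠ 0`; `p` is the profit
ratio. -/
noncomputable def rewardBuyer (n : ℕ) (p : ℝ) (s : Fin (n + 1)) (a : Fin 4) (d : Fin 21) : ℝ :=
  ((d : ℕ) : ℝ) * p * (1 - attackProb n s a) - ((d : ℕ) : ℝ) * (1 - p) * attackProb n s a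

/-- The profit of the seller from the honest customers at `s ≠ 0`; `f` is the fraction of customers
not willing to wait for a confirmation. -/
noncomputable def rewardHonest (p f : ℝ) (a : Fin 4) : ℝ :=
  if Confirms a then 10 * p * (1 - f) else 10 * p

/-- The profit of the seller in one round. -/
noncomputable def reward (n : ℕ) (p f : ℝ) (s : Fin (n + 1)) (a : Fin 4) (d : Fin 21) : ℝ :=
  if s = 0 then 0 else rewardBuyer n p s a d + rewardHonest p f a

theorem attackProb_mem {n : ℕ} (hn : 1 ≤ n) {s : Fin (n + 1)} (hs : s ≠ 0) (a : Fin 4) :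
    0 ≤ attackProb n s a ∧ attackProb n s a ≤ 1 := by
  have hn' : (0 : ℝ) < n := by exact_mod_cast hn
  have h1 : (1 : ℝ) ≤ (s : ℕ) := by
    have : 1 ≤ (s : ℕ) := Nat.one_le_iff_ne_zero.2 fun h => hs (Fin.ext h)
    exact_mod_cast this
  have h2 : ((s : ℕ) : ℝ) ≤ n := by
    have := Nat.lt_succ_iff.1 s.2
    exact_mod_cast this
  have h3 : (((s : ℕ) : ℝ) - 1) * 0.4 / n ≤ 0.4 := by
    rw [div_le_iff₀ hn']; nlinarith
  have h4 : 0 ≤ (((s : ℕ) : ℝ) - 1) * 0.4 / n :=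
    div_nonneg (mul_nonneg (by linarith) (by norm_num)) hn'.le
  unfold attackProb successProb
  split_ifs
  · norm_num
  · constructor <;> linarith

theorem transProb_nonneg {n : ℕ} (hn : 1 ≤ n) {pdc : ℝ} (h0 : 0 < pdc) (h1 : pdc ≤ 1)
    (s : Fin (n + 1)) (a : Fin 4) (t : Fin (n + 1)) : 0 ≤ transProb n pdc s a t := by
  unfold transProb
  split_ifs with hs
  · exact le_rfl
  · positivity
  · exact zero_le_one
  · exact le_rfl
  · obtain ⟨h2, h3⟩ := attackProb_mem hn hs a
    have h4 : 0 ≤ 1 - attackProb n s a := by linarith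
    have h5 : 0 ≤ 1 - pdc := by linarith
    unfold transSucc transFail
    refine add_nonneg ?_ ?_ <;> split_ifs <;> positivity

theorem sum_transProb {n : ℕ} (hn : 1 ≤ n) (pdc : ℝ) (s : Fin (n + 1)) (a : Fin 4) :
    ∑ t, transProb n pdc s a t = 1 := by
  have hn' : (n : ℝ) ≠ 0 := by positivity
  unfold transProb
  split_ifs with hs
  · simp [Fin.sum_univ_succ, hn']
  · simp
  · have hmem : s ∈ nbhd n s := by simp [nbhd, hs]
    have hcard : ((nbhd n s).card : ℝ) ≠ 0 := by
      exact_mod_cast (Finset.card_pos.2 ⟨s, hmem⟩).ne'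
    have h0 : (0 : Fin (n + 1)) ∉ nbhd n s := by simp [nbhd]
    have key : ∀ t, transFail n pdc s a t = (if t = 0 then pdc * (1 - attackProb n s a) else 0) +
        (if t ∈ nbhd n s then (1 - attackProb n s a) / (nbhd n s).card * (1 - pdc) else 0) := by
      intro t
      unfold transFail
      by_cases ht : t = 0
      · subst ht; simp [h0]
      · simp [ht]
    rw [Finset.sum_add_distrib, Finset.sum_congr rfl fun t _ => key t, Finset.sum_add_distrib]
    simp only [transSucc, Finset.sum_ite_eq', Finset.mem_univ, if_true, Finset.sum_ite_mem,
      Finset.univ_inter, Finset.sum_const, nsmul_eq_mul]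
    field_simp
    ring

/-- The zero-confirmation double-spending game: Player 1 is the seller and Player 2 is the malicious
buyer. At the shuffling state each player has the single action `0`; at any other state the seller
has all four actions and the buyer chooses between `1` and `20` units. -/
noncomputable def game (n : ℕ) (hn : 1 ≤ n) (pdc p f : ℝ) (h0 : 0 < pdc) (h1 : pdc ≤ 1) :
    ConcurrentGame (Fin (n + 1)) (Fin 4) (Fin 21) where
  mov₁ s := if s = 0 then {0} else Set.univ
  mov₂ s := if s = 0 then {0} else {d | d ≠ 0}
  mov₁_nonempty s := ⟨0, by split_ifs <;> simp⟩
  mov₂_nonempty s := by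
    split_ifs
    · exact ⟨0, rfl⟩
    · exact ⟨1, by simp⟩
  trans s a _ := PMF.ofFintype (fun t => ENNReal.ofReal (transProb n pdc s a t)) (by
    rw [← ENNReal.ofReal_sum_of_nonneg fun t _ => transProb_nonneg hn h0 h1 s a t,
      sum_transProb hn, ENNReal.ofReal_one])
  reward := reward n p f

end DoubleSpending

/-! Everything rests on one fact: from any state other than `0`, whatever the moves, the next state
is `0` with probability at least `pdc / 2`.

Value. Subtract a constant `v` from all rewards and stop the game at `0`. The Bellman operator of
this stopped game, built from von Neumann values of matrix games, is then a sup-norm contraction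
with factor `1 - pdc / 2`, and its fixed point is Lipschitz in `v`. Moving `v` across the range of
the rewards, the intermediate value theorem gives a `v` for which the equation also holds at `0`.
Hence `v` and some `h` solve the average-reward optimality equation (`exists_optimality_equation`).
Optimal mixed moves in the resulting matrix games form stationary strategies under which reward plus
expected change of `h` has conditional mean at least `v`, respectively at most `v`, against any
opponent.

From drift to averages. A Chernoff bound and Borel–Cantelli give a strong law for bounded increments
with non-negative conditional means (`ae_eventually_sum_ge`). Since the `h`-terms telescope to
something bounded, the averages are almost surely asymptotically on the correct side of `v`, which
yields both values and the seller's guarantee.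

Ergodicity. The same law, applied with the indicator of `t` as reward and a suitable potential,
shows that visits to `t` have positive lower density. -/

/-! ### Finite expectations and an exponential moment bound -/

namespace PMF

variable {α β : Type*} [Fintype α] [Fintype β]

/-- The expectation of a real function under a probability mass function on a finite type. -/
noncomputable def expect (q : PMF α) (f : α → ℝ) : ℝ := ∑ a, (q a).toReal * f a

theorem sum_toReal (q : PMF α) : ∑ a, (q a).toReal = 1 := by
  rw [← ENNReal.toReal_sum fun a _ => q.apply_ne_top a, ← tsum_fintype (L := .unconditional _),
    q.tsum_coe, ENNReal.toReal_one]

theorem expect_mono (q : PMF α) {f g : α → ℝ} (h : ∀ a, f a ≤ g a) : q.expect f ≤ q.expect g :=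
  Finset.sum_le_sum fun a _ => mul_le_mul_of_nonneg_left (h a) ENNReal.toReal_nonneg

theorem expect_const (q : PMF α) (c : ℝ) : q.expect (fun _ => c) = c := by
  simp [expect, ← Finset.sum_mul, sum_toReal]

theorem expect_add (q : PMF α) (f g : α → ℝ) :
    q.expect (fun a => f a + g a) = q.expect f + q.expect g := by
  simp [expect, mul_add, Finset.sum_add_distrib]

theorem expect_sub (q : PMF α) (f g : α → ℝ) :
    q.expect (fun a => f a - g a) = q.expect f - q.expect g := by
  simp [expect, mul_sub, Finset.sum_sub_distrib]

theorem expect_neg (q : PMF α) (f : α → ℝ) : q.expect (fun a => -f a) = -q.expect f := by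
  simp [expect]

theorem expect_const_mul (q : PMF α) (c : ℝ) (f : α → ℝ) :
    q.expect (fun a => c * f a) = c * q.expect f := by
  simp only [expect, Finset.mul_sum]
  exact Finset.sum_congr rfl fun a _ => by ring

theorem expect_pure (a : α) (f : α → ℝ) : (PMF.pure a).expect f = f a := by
  classical
  rw [expect, Finset.sum_eq_single a] <;> simp +contextual [PMF.pure_apply]

theorem expect_bind (q : PMF α) (g : α → PMF β) (f : β → ℝ) :
    (q.bind g).expect f = q.expect fun a => (g a).expect f := by
  have key : ∀ b, ((q.bind g) b).toReal = ∑ a, (q a).toReal * (g a b).toReal := fun b => by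
    rw [PMF.bind_apply, tsum_fintype, ENNReal.toReal_sum fun a _ =>
      ENNReal.mul_ne_top (q.apply_ne_top a) ((g a).apply_ne_top b)]
    simp
  simp only [expect, key, Finset.sum_mul, Finset.mul_sum]
  rw [Finset.sum_comm]
  exact Finset.sum_congr rfl fun a _ => Finset.sum_congr rfl fun b _ => by ring

theorem expect_map (q : PMF α) (g : α → β) (f : β → ℝ) :
    (q.map g).expect f = q.expect fun a => f (g a) := by
  rw [← PMF.bind_pure_comp, expect_bind]
  simp [expect_pure]

theorem lintegral_ofReal [MeasurableSpace α] [MeasurableSingletonClass α] (q : PMF α) {f : α → ℝ}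
    (hf : ∀ a, 0 ≤ f a) :
    ∫⁻ a, ENNReal.ofReal (f a) ∂q.toMeasure = ENNReal.ofReal (q.expect f) := by
  rw [lintegral_fintype, expect, ENNReal.ofReal_sum_of_nonneg fun a _ =>
    mul_nonneg ENNReal.toReal_nonneg (hf a)]
  refine Finset.sum_congr rfl fun a _ => ?_
  rw [PMF.toMeasure_apply_singleton _ _ (measurableSet_singleton a),
    ENNReal.ofReal_mul ENNReal.toReal_nonneg, ENNReal.ofReal_toReal (q.apply_ne_top a), mul_comm]

/-- The exponential moment bound behind the Azuma inequality, for a bounded variable whose mean is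
non-negative. -/
theorem expect_exp_neg_le (q : PMF α) {f : α → ℝ} {K θ : ℝ} (hK : ∀ a, |f a| ≤ K)
    (hmean : 0 ≤ q.expect f) (hθ : 0 ≤ θ) (hθK : θ * K ≤ 1) :
    q.expect (fun a => Real.exp (-(θ * f a))) ≤ Real.exp ((θ * K) ^ 2) := by
  -- This is `exp u ≤ 1 + u + u ^ 2` for `|u| ≤ 1`, with `u = -(θ * f a)`; averaging then removes
  -- the linear term through `hmean`.
  have h1 : ∀ a, Real.exp (-(θ * f a)) ≤ (1 + (θ * K) ^ 2) - θ * f a := fun a => by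
    have h2 : |-(θ * f a)| ≤ θ * K := by
      rw [abs_neg, abs_mul, abs_of_nonneg hθ]
      exact mul_le_mul_of_nonneg_left (hK a) hθ
    have h3 := (abs_le.1 (Real.abs_exp_sub_one_sub_id_le (h2.trans hθK))).2
    have h4 : (-(θ * f a)) ^ 2 ≤ (θ * K) ^ 2 := sq_le_sq' (abs_le.1 h2).1 (abs_le.1 h2).2
    linarith
  calc _ ≤ q.expect fun a => (1 + (θ * K) ^ 2) - θ * f a := q.expect_mono h1
    _ = (1 + (θ * K) ^ 2) - θ * q.expect f := by rw [expect_sub, expect_const, expect_const_mul]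
    _ ≤ 1 + (θ * K) ^ 2 := by linarith [mul_nonneg hθ hmean]
    _ ≤ _ := by rw [add_comm]; exact Real.add_one_le_exp _

end PMF

/-! ### A strong law along plays -/

namespace ConcurrentGame

variable {S A B : Type*} [Fintype S] [Fintype A] [Fintype B] (G : ConcurrentGame S A B)

/-- The expected value of `h` at the successor state of a round. -/
noncomputable def next (h : S → ℝ) (y : S × A × B) : ℝ := (G.trans y.1 y.2.1 y.2.2).expect h

theorem expect_nextRound (σ₁ : G.Strategy₁) (σ₂ : G.Strategy₂) (x : List (S × A × B))
    (y : S × A × B) (f : S × A × B → ℝ) :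
    (G.nextRound σ₁ σ₂ x y).expect f =
      G.next (fun t => (G.round σ₁ σ₂ (x ++ [y]) t).expect f) y :=
  PMF.expect_bind _ _ _

theorem expect_round (σ₁ : G.Strategy₁) (σ₂ : G.Strategy₂) (x : List (S × A × B)) (s : S)
    (f : S × A × B → ℝ) :
    (G.round σ₁ σ₂ x s).expect f =
      (σ₁.choice x s).expect fun a => (σ₂.choice x s).expect fun b => f (s, a, b) := by
  simp only [round, PMF.expect_bind, PMF.expect_map]

variable [MeasurableSpace S] [MeasurableSpace A] [MeasurableSpace B]
  [MeasurableSingletonClass S] [MeasurableSingletonClass A] [MeasurableSingletonClass B]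

instance (σ₁ : G.Strategy₁) (σ₂ : G.Strategy₂) (s : S) :
    IsProbabilityMeasure (G.playMeasure σ₁ σ₂ s) := by
  have := PMF.toMeasure.isProbabilityMeasure (G.round σ₁ σ₂ [] s)
  unfold playMeasure
  infer_instance

/-- The trajectory measure extends the law of the first rounds by the step kernel. Any `F` is
allowed, since all finite blocks of rounds live in a finite discrete space. -/
theorem lintegral_playMeasure_succ (σ₁ : G.Strategy₁) (σ₂ : G.Strategy₂) (s : S) (k : ℕ)
    (F : (Π _ : Finset.Iic k, S × A × B) → S × A × B → ENNReal) :
    ∫⁻ ω, F (Preorder.frestrictLe k ω) (ω (k + 1)) ∂(G.playMeasure σ₁ σ₂ s) =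
      ∫⁻ ω, ∫⁻ y, F (Preorder.frestrictLe k ω) y ∂(G.stepKernel σ₁ σ₂ k (Preorder.frestrictLe k ω))
        ∂(G.playMeasure σ₁ σ₂ s) := by
  have := PMF.toMeasure.isProbabilityMeasure (G.round σ₁ σ₂ [] s)
  have hF : Measurable (Function.uncurry F) := measurable_of_countable _
  have key := Kernel.map_frestrictLe_trajMeasure_compProd_eq_map_trajMeasure
    (X := fun _ => S × A × B) (μ₀ := (G.round σ₁ σ₂ [] s).toMeasure)
    (κ := G.stepKernel σ₁ σ₂) (a := k)
  have h1 := congrArg (fun μ => ∫⁻ z, Function.uncurry F z ∂μ) key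
  rw [Measure.lintegral_compProd hF, lintegral_map (measurable_of_countable _) (by fun_prop),
    lintegral_map hF (by fun_prop)] at h1
  exact h1.symm

theorem lintegral_stepKernel (σ₁ : G.Strategy₁) (σ₂ : G.Strategy₂) (k : ℕ)
    (h : Π _ : Finset.Iic k, S × A × B) {f : S × A × B → ℝ} (hf : ∀ y, 0 ≤ f y) :
    ∫⁻ y, ENNReal.ofReal (f y) ∂(G.stepKernel σ₁ σ₂ k h) =
      ENNReal.ofReal ((G.nextRound σ₁ σ₂
        (List.ofFn fun i : Fin k => h ⟨i, Finset.mem_Iic.2 i.2.le⟩)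
        (h ⟨k, Finset.mem_Iic.2 le_rfl⟩)).expect f) :=
  PMF.lintegral_ofReal _ hf

/-- Conditionally on the past, the last exponential factor has mean at most `exp ((θ * K) ^ 2)`, so
the bounds multiply up by induction. No independence is needed. -/
theorem lintegral_exp_neg_sum_le (σ₁ : G.Strategy₁) (σ₂ : G.Strategy₂) (s : S)
    {W : S × A × B → S × A × B → ℝ} {K θ : ℝ} (hK : ∀ y y', |W y y'| ≤ K)
    (hW : ∀ x y, 0 ≤ (G.nextRound σ₁ σ₂ x y).expect (W y)) (hθ : 0 ≤ θ) (hθK : θ * K ≤ 1)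
    (T : ℕ) :
    ∫⁻ ω, ENNReal.ofReal (Real.exp (-(θ * ∑ i ∈ Finset.range T, W (ω i) (ω (i + 1)))))
      ∂(G.playMeasure σ₁ σ₂ s) ≤ ENNReal.ofReal (Real.exp (T * (θ * K) ^ 2)) := by
  induction T with
  | zero => simp
  | succ k ih =>
    -- The first factor depends only on rounds `0, …, k` and is constant for the inner integral; the
    -- second alone contains the new round.
    have h1 := G.lintegral_playMeasure_succ σ₁ σ₂ s k fun h y =>
      ENNReal.ofReal (Real.exp (-(θ * ∑ i : Fin k,
        W (h ⟨i, Finset.mem_Iic.2 i.2.le⟩) (h ⟨i + 1, Finset.mem_Iic.2 i.2⟩)))) *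
      ENNReal.ofReal (Real.exp (-(θ * W (h ⟨k, Finset.mem_Iic.2 le_rfl⟩) y)))
    simp only [Preorder.frestrictLe_apply] at h1
    have h2 : ∀ ω : ℕ → S × A × B,
        ENNReal.ofReal (Real.exp (-(θ * ∑ i ∈ Finset.range (k + 1), W (ω i) (ω (i + 1))))) =
        ENNReal.ofReal (Real.exp (-(θ * ∑ i : Fin k, W (ω i) (ω (i + 1))))) *
          ENNReal.ofReal (Real.exp (-(θ * W (ω k) (ω (k + 1))))) := fun ω => by
      rw [← ENNReal.ofReal_mul (Real.exp_pos _).le, ← Real.exp_add, Finset.sum_range_succ,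
        Finset.sum_range]
      congr 2
      ring
    simp only [h2]
    rw [h1]
    calc _ ≤ ∫⁻ ω, ENNReal.ofReal (Real.exp (-(θ * ∑ i ∈ Finset.range k, W (ω i) (ω (i + 1))))) *
          ENNReal.ofReal (Real.exp ((θ * K) ^ 2)) ∂(G.playMeasure σ₁ σ₂ s) := by
          refine lintegral_mono fun ω => ?_
          dsimp only
          rw [lintegral_const_mul _ (measurable_of_countable _),
            G.lintegral_stepKernel _ _ _ _ fun _ => (Real.exp_pos _).le, Finset.sum_range]
          gcongr
          exact PMF.expect_exp_neg_le _ (hK _) (hW _ _) hθ hθK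
      _ ≤ _ := by
          rw [lintegral_mul_const' _ _ ENNReal.ofReal_ne_top]
          refine (mul_le_mul_left ih _).trans ?_
          rw [← ENNReal.ofReal_mul (Real.exp_pos _).le, ← Real.exp_add]
          refine ENNReal.ofReal_le_ofReal (Real.exp_le_exp.2 (le_of_eq ?_))
          push_cast
          ring

/-- The strong law for bounded increments whose conditional means are non-negative. -/
theorem ae_eventually_sum_ge (σ₁ : G.Strategy₁) (σ₂ : G.Strategy₂) (s : S)
    {W : S × A × B → S × A × B → ℝ} (hW : ∀ x y, 0 ≤ (G.nextRound σ₁ σ₂ x y).expect (W y))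
    {ε : ℝ} (hε : 0 < ε) :
    ∀ᵐ ω ∂(G.playMeasure σ₁ σ₂ s),
      ∀ᶠ T : ℕ in atTop, -(ε * T) ≤ ∑ i ∈ Finset.range T, W (ω i) (ω (i + 1)) := by
  obtain ⟨K, hK1, hK⟩ : ∃ K : ℝ, 1 ≤ K ∧ ∀ y y', |W y y'| ≤ K := by
    obtain ⟨C, hC⟩ := (Set.finite_range fun z : (S × A × B) × (S × A × B) => |W z.1 z.2|).bddAbove
    exact ⟨max 1 C, le_max_left _ _, fun y y' => (hC ⟨(y, y'), rfl⟩).trans (le_max_right _ _)⟩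
  -- The Chernoff exponent at time `T` is `-θ * ε * T + T * (θ * K) ^ 2`. The bound `θ ≤ ε / (2 * K
  -- ^ 2)` makes it at most `-(θ * ε / 2) * T`, hence geometric decay with ratio `r` below.
  obtain ⟨θ, hθ, hθK, hθε⟩ : ∃ θ : ℝ, 0 < θ ∧ θ * K ≤ 1 ∧ (θ * K) ^ 2 ≤ θ * ε / 2 := by
    have hK0 : 0 < K := by linarith
    refine ⟨min (1 / K) (ε / (2 * K ^ 2)), by positivity, ?_, ?_⟩
    · exact (mul_le_mul_of_nonneg_right (min_le_left _ _) hK0.le).trans (by field_simp; rfl)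
    · set θ := min (1 / K) (ε / (2 * K ^ 2)) with hdef
      have h0 : 0 < θ := by positivity
      have h1 : θ * (2 * K ^ 2) ≤ ε := (le_div_iff₀ (by positivity)).1 (min_le_right _ _)
      nlinarith [mul_le_mul_of_nonneg_left h1 h0.le]
  set P := G.playMeasure σ₁ σ₂ s
  set r : ENNReal := ENNReal.ofReal (Real.exp (-(θ * ε / 2))) with hr
  have hr1 : r < 1 := by
    rw [hr, ENNReal.ofReal_lt_one, Real.exp_lt_one_iff]
    have := mul_pos hθ hε
    linarith
  have hb : ∀ T : ℕ, P {ω | ¬ -(ε * T) ≤ ∑ i ∈ Finset.range T, W (ω i) (ω (i + 1))} ≤ r ^ T := by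
    intro T
    have h1 := mul_meas_ge_le_lintegral₀ (μ := P)
      (f := fun ω => ENNReal.ofReal (Real.exp (-(θ * ∑ i ∈ Finset.range T, W (ω i) (ω (i + 1))))))
      (by
        have hm : Measurable fun z : (S × A × B) × S × A × B => W z.1 z.2 :=
          measurable_of_countable _
        have hp : ∀ i, Measurable fun ω : ℕ → S × A × B => (ω i, ω (i + 1)) := fun i => by fun_prop
        have : Measurable fun ω : ℕ → S × A × B => ∑ i ∈ Finset.range T, W (ω i) (ω (i + 1)) :=
          Finset.measurable_sum _ fun i _ => hm.comp (hp i)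
        fun_prop) (ENNReal.ofReal (Real.exp (θ * (ε * T))))
    have h2 := h1.trans (G.lintegral_exp_neg_sum_le σ₁ σ₂ s hK hW hθ.le hθK T)
    have h3 : {ω : ℕ → S × A × B | ¬ -(ε * T) ≤ ∑ i ∈ Finset.range T, W (ω i) (ω (i + 1))} ⊆
        {ω | ENNReal.ofReal (Real.exp (θ * (ε * T))) ≤
          ENNReal.ofReal (Real.exp (-(θ * ∑ i ∈ Finset.range T, W (ω i) (ω (i + 1)))))} := by
      intro ω hω
      simp only [Set.mem_ofPred_eq, not_le] at hω ⊢
      refine ENNReal.ofReal_le_ofReal (Real.exp_le_exp.2 ?_)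
      rw [← mul_neg]
      exact mul_le_mul_of_nonneg_left (by linarith) hθ.le
    refine (measure_mono h3).trans ?_
    have h4 : ENNReal.ofReal (Real.exp (-(θ * (ε * T)))) *
        ENNReal.ofReal (Real.exp (θ * (ε * T))) = 1 := by
      rw [← ENNReal.ofReal_mul (Real.exp_pos _).le, ← Real.exp_add]
      simp
    calc _ = ENNReal.ofReal (Real.exp (-(θ * (ε * T)))) * (ENNReal.ofReal (Real.exp (θ * (ε * T))) *
          P {ω | ENNReal.ofReal (Real.exp (θ * (ε * T))) ≤
          ENNReal.ofReal (Real.exp (-(θ * ∑ i ∈ Finset.range T, W (ω i) (ω (i + 1)))))}) := by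
          rw [← mul_assoc (ENNReal.ofReal _), h4, one_mul]
      _ ≤ ENNReal.ofReal (Real.exp (-(θ * (ε * T)))) *
          ENNReal.ofReal (Real.exp (T * (θ * K) ^ 2)) := by gcongr
      _ ≤ r ^ T := by
          rw [← ENNReal.ofReal_mul (Real.exp_pos _).le, ← Real.exp_add, hr,
            ← ENNReal.ofReal_pow (Real.exp_pos _).le, ← Real.exp_nat_mul]
          refine ENNReal.ofReal_le_ofReal (Real.exp_le_exp.2 ?_)
          have := mul_le_mul_of_nonneg_left hθε (Nat.cast_nonneg (α := ℝ) T)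
          linarith
  -- Borel–Cantelli: the failure probabilities are dominated by a convergent geometric series.
  have hsum : ∑' T : ℕ, P {ω | ¬ -(ε * T) ≤ ∑ i ∈ Finset.range T, W (ω i) (ω (i + 1))} ≠ ⊤ := by
    refine ne_top_of_le_ne_top ?_ (ENNReal.tsum_le_tsum hb)
    rw [ENNReal.tsum_geometric]
    exact ENNReal.inv_ne_top.2 (tsub_pos_of_lt hr1).ne'
  have h0 := measure_setOfPred_frequently_eq_zero hsum
  rw [ae_iff]
  simpa only [not_eventually] using h0

/-- A solution `h` of the average-reward optimality inequality bounds the averages of `ρ`. -/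
theorem ae_eventually_sum_ge_of_optimality (σ₁ : G.Strategy₁) (σ₂ : G.Strategy₂) (s : S)
    {ρ : S × A × B → ℝ} {h : S → ℝ} {v : ℝ}
    (hh : ∀ x t, v + h t ≤ (G.round σ₁ σ₂ x t).expect fun y => ρ y + G.next h y)
    {ε : ℝ} (hε : 0 < ε) :
    ∀ᵐ ω ∂(G.playMeasure σ₁ σ₂ s),
      ∀ᶠ T : ℕ in atTop, (v - ε) * T ≤ ∑ i ∈ Finset.range T, ρ (ω i) := by
  -- A round contains the moves but not the successor, so the potential used is `G.next h`. Drawing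
  -- the successor `t` of `y` and applying `hh` at `t` gives conditional mean at least `v + G.next h
  -- y`.
  have hW : ∀ x y, 0 ≤ (G.nextRound σ₁ σ₂ x y).expect fun y' =>
      (ρ y' + G.next h y') - (v + G.next h y) := by
    intro x y
    rw [PMF.expect_sub, PMF.expect_const, sub_nonneg, expect_nextRound]
    calc v + G.next h y = G.next (fun t => v + h t) y := by
          rw [next, next, PMF.expect_add, PMF.expect_const]
      _ ≤ _ := PMF.expect_mono _ fun t => hh _ t
  filter_upwards [G.ae_eventually_sum_ge σ₁ σ₂ s hW (half_pos hε)] with ω hω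
  -- `L` bounds the boundary term left by telescoping; half of `ε` pays for the strong law, the
  -- other half for `L`.
  obtain ⟨L, hL⟩ := (Set.finite_range fun y : S × A × B =>
    |ρ (ω 0) + G.next h (ω 0) - ρ y - G.next h y|).bddAbove
  have key : ∀ T : ℕ, ∑ i ∈ Finset.range T,
      ((ρ (ω (i + 1)) + G.next h (ω (i + 1))) - (v + G.next h (ω i))) =
      ∑ i ∈ Finset.range T, ρ (ω i) - v * T
        - (ρ (ω 0) + G.next h (ω 0) - ρ (ω T) - G.next h (ω T)) := by
    intro T
    induction T with
    | zero => simp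
    | succ k ih =>
      rw [Finset.sum_range_succ, ih, Finset.sum_range_succ]
      push_cast
      ring
  filter_upwards [hω, eventually_ge_atTop ⌈L / (ε / 2)⌉₊] with T hT hTL
  rw [key] at hT
  have h1 := (abs_le.1 (hL ⟨ω T, rfl⟩)).1
  have h2 : L ≤ T * (ε / 2) := (div_le_iff₀ (half_pos hε)).1 (Nat.ceil_le.1 hTL)
  linarith

end ConcurrentGame

/-! ### The minimax theorem for matrix games -/

section Minimax

variable {α β : Type*} [Fintype α] [Fintype β]

/-- The probability vectors that are concentrated on `m`. -/
def stdSimplexOn (m : Set α) : Set (α → ℝ) := stdSimplex ℝ α ∩ {x | ∀ a ∉ m, x a = 0}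

theorem convex_stdSimplexOn (m : Set α) : Convex ℝ (stdSimplexOn m) := by
  refine (convex_stdSimplex ℝ α).inter fun x hx y hy r t _ _ _ a ha => ?_
  simp [hx a ha, hy a ha]

theorem isCompact_stdSimplexOn (m : Set α) : IsCompact (stdSimplexOn m) := by
  refine (isCompact_stdSimplex ℝ α).inter_right ?_
  have : {x : α → ℝ | ∀ a ∉ m, x a = 0} = ⋂ a ∈ mᶜ, {x | x a = 0} := by
    ext x
    simp
  rw [this]
  exact isClosed_biInter fun a _ => isClosed_eq (continuous_apply a) continuous_const

theorem nonempty_stdSimplexOn {m : Set α} (hm : m.Nonempty) : (stdSimplexOn m).Nonempty := by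
  classical
  obtain ⟨i, hi⟩ := hm
  refine ⟨Pi.single i 1, single_mem_stdSimplex ℝ i, fun a ha => ?_⟩
  exact Pi.single_eq_of_ne (fun h : a = i => ha (h.symm ▸ hi)) _

theorem PMF.mem_stdSimplexOn {m : Set α} (q : PMF α) (hq : q.support ⊆ m) :
    (fun a => (q a).toReal) ∈ stdSimplexOn m := by
  refine ⟨⟨fun a => ENNReal.toReal_nonneg, q.sum_toReal⟩, fun a ha => ?_⟩
  have : q a = 0 := by
    by_contra h
    exact ha (hq ((q.mem_support_iff a).2 h))
  simp [this]

theorem exists_pmf_of_mem_stdSimplexOn {m : Set α} {x : α → ℝ} (hx : x ∈ stdSimplexOn m) :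
    ∃ q : PMF α, q.support ⊆ m ∧ ∀ a, (q a).toReal = x a := by
  refine ⟨PMF.ofFintype (fun a => ENNReal.ofReal (x a)) ?_, fun a ha => ?_, fun a => ?_⟩
  · rw [← ENNReal.ofReal_sum_of_nonneg fun a _ => hx.1.1 a, hx.1.2, ENNReal.ofReal_one]
  · by_contra h
    simp [hx.2 a h] at ha
  · simp [hx.1.1 a]

/-- The von Neumann minimax theorem, for mixed moves with prescribed supports. -/
theorem exists_pmf_saddle {m₁ : Set α} {m₂ : Set β} (h₁ : m₁.Nonempty) (h₂ : m₂.Nonempty)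
    (Q : α → β → ℝ) :
    ∃ (w : ℝ) (q₁ : PMF α) (q₂ : PMF β), q₁.support ⊆ m₁ ∧ q₂.support ⊆ m₂ ∧
      (∀ q : PMF β, q.support ⊆ m₂ → w ≤ q₁.expect fun a => q.expect fun b => Q a b) ∧
      ∀ q : PMF α, q.support ⊆ m₁ → (q.expect fun a => q₂.expect fun b => Q a b) ≤ w := by
  -- The minimizer's vector comes first because Sion's theorem takes the convex variable as first
  -- argument.
  let φ : (β → ℝ) → (α → ℝ) → ℝ := fun y x => ∑ a, x a * ∑ b, y b * Q a b
  have hcy : ∀ x, Continuous fun y => φ y x := fun x => by fun_prop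
  have hcx : ∀ y, Continuous fun x => φ y x := fun y => by fun_prop
  have hly : ∀ x, IsLinearMap ℝ fun y => φ y x := fun x =>
    ⟨fun y y' => by simp [φ, add_mul, mul_add, Finset.sum_add_distrib], fun c y => by
      simp only [φ, Pi.smul_apply, smul_eq_mul, Finset.mul_sum]
      exact Finset.sum_congr rfl fun a _ => Finset.sum_congr rfl fun b _ => by ring⟩
  have hlx : ∀ y, IsLinearMap ℝ fun x => φ y x := fun y =>
    ⟨fun x x' => by simp [φ, add_mul, Finset.sum_add_distrib], fun c x => by
      simp only [φ, Pi.smul_apply, smul_eq_mul, Finset.mul_sum]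
      exact Finset.sum_congr rfl fun a _ => Finset.sum_congr rfl fun b _ => by ring⟩
  obtain ⟨y, hy, x, hx, hxy⟩ := Sion.exists_isSaddlePointOn (f := φ)
    (nonempty_stdSimplexOn h₂) (convex_stdSimplexOn m₂) (isCompact_stdSimplexOn m₂)
    (fun x _ => (hcy x).lowerSemicontinuous.lowerSemicontinuousOn _)
    (fun x _ => ((hly x).mk' _ |>.convexOn (convex_stdSimplexOn m₂)).quasiconvexOn)
    (convex_stdSimplexOn m₁) (nonempty_stdSimplexOn h₁) (isCompact_stdSimplexOn m₁)
    (fun y _ => (hcx y).upperSemicontinuous.upperSemicontinuousOn _)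
    (fun y _ => ((hlx y).mk' _ |>.concaveOn (convex_stdSimplexOn m₁)).quasiconcaveOn)
  obtain ⟨q₁, hq₁, hx₁⟩ := exists_pmf_of_mem_stdSimplexOn hx
  obtain ⟨q₂, hq₂, hy₂⟩ := exists_pmf_of_mem_stdSimplexOn hy
  refine ⟨φ y x, q₁, q₂, hq₁, hq₂, fun q hq => ?_, fun q hq => ?_⟩
  · refine (hxy _ (q.mem_stdSimplexOn hq) x hx).trans (le_of_eq ?_)
    simp [φ, PMF.expect, hx₁]
  · refine le_trans (le_of_eq ?_) (hxy y hy _ (q.mem_stdSimplexOn hq))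
    simp [φ, PMF.expect, hy₂]

end Minimax

/-! ### Stage games and the optimality equation -/

/-- Only the mass off `z`, at most `1 - c`, can contribute, and it contributes at most `D` per unit.
This is the source of the contraction factor. -/
theorem PMF.expect_le_of_vanish {α : Type*} [Fintype α] (q : PMF α) {z : α} {g : α → ℝ} {c D : ℝ}
    (hz : g z ≤ 0) (hg : ∀ a, g a ≤ D) (hD : 0 ≤ D) (hc : c ≤ (q z).toReal) :
    q.expect g ≤ (1 - c) * D := by
  classical
  have h1 : ∀ a, g a ≤ D - D * (if a = z then 1 else 0) := fun a => by
    split_ifs with h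
    · subst h; linarith
    · simpa using hg a
  refine (q.expect_mono h1).trans ?_
  have h2 : (q.expect fun a => if a = z then (1 : ℝ) else 0) = (q z).toReal := by
    simp [PMF.expect]
  rw [expect_sub, expect_const, expect_const_mul, h2]
  nlinarith

namespace ConcurrentGame

variable {S A B : Type*} [Fintype A] [Fintype B] (G : ConcurrentGame S A B)

/-- The value of the matrix game `Q` that is played once with the moves available at `s`. -/
noncomputable def stageValue (s : S) (Q : A → B → ℝ) : ℝ :=
  (exists_pmf_saddle (G.mov₁_nonempty s) (G.mov₂_nonempty s) Q).choose

theorem stageValue_spec (s : S) (Q : A → B → ℝ) :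
    ∃ (q₁ : PMF A) (q₂ : PMF B), q₁.support ⊆ G.mov₁ s ∧ q₂.support ⊆ G.mov₂ s ∧
      (∀ q : PMF B, q.support ⊆ G.mov₂ s →
        G.stageValue s Q ≤ q₁.expect fun a => q.expect fun b => Q a b) ∧
      ∀ q : PMF A, q.support ⊆ G.mov₁ s →
        (q.expect fun a => q₂.expect fun b => Q a b) ≤ G.stageValue s Q :=
  (exists_pmf_saddle (G.mov₁_nonempty s) (G.mov₂_nonempty s) Q).choose_spec

/-- Play the maximizer's optimal move for `Q` against the minimizer's optimal move for `Q'`. -/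
theorem stageValue_le_add (s : S) {Q Q' : A → B → ℝ} {δ : ℝ} (h : ∀ a b, Q a b ≤ Q' a b + δ) :
    G.stageValue s Q ≤ G.stageValue s Q' + δ := by
  obtain ⟨q₁, -, hq₁, -, h1, -⟩ := G.stageValue_spec s Q
  obtain ⟨-, q₂, -, hq₂, -, h2⟩ := G.stageValue_spec s Q'
  calc _ ≤ q₁.expect fun a => q₂.expect fun b => Q a b := h1 q₂ hq₂
    _ ≤ q₁.expect fun a => q₂.expect fun b => Q' a b + δ :=
      q₁.expect_mono fun a => q₂.expect_mono fun b => h a b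
    _ = (q₁.expect fun a => q₂.expect fun b => Q' a b) + δ := by
      simp only [PMF.expect_add, PMF.expect_const]
    _ ≤ _ := by gcongr; exact h2 q₁ hq₁

theorem stageValue_const (s : S) (c : ℝ) : G.stageValue s (fun _ _ => c) = c := by
  obtain ⟨q₁, q₂, hq₁, hq₂, h1, h2⟩ := G.stageValue_spec s fun _ _ => c
  have h1 := h1 q₂ hq₂
  have h2 := h2 q₁ hq₁
  simp only [PMF.expect_const] at h1 h2
  exact le_antisymm h1 h2

theorem abs_stageValue_sub_le (s : S) {Q Q' : A → B → ℝ} {δ : ℝ}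
    (h : ∀ a b, |Q a b - Q' a b| ≤ δ) : |G.stageValue s Q - G.stageValue s Q'| ≤ δ := by
  rw [abs_sub_le_iff]
  constructor
  · linarith [G.stageValue_le_add s fun a b => show Q a b ≤ Q' a b + δ by
      linarith [(abs_le.1 (h a b)).2]]
  · linarith [G.stageValue_le_add s fun a b => show Q' a b ≤ Q a b + δ by
      linarith [(abs_le.1 (h a b)).1]]

theorem stageValue_le (s : S) {Q : A → B → ℝ} {c : ℝ} (h : ∀ a b, Q a b ≤ c) :
    G.stageValue s Q ≤ c := by
  have := G.stageValue_le_add s (Q := Q) (Q' := fun _ _ => 0) (δ := c) fun a b => by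
    simpa using h a b
  simpa [stageValue_const] using this

theorem le_stageValue (s : S) {Q : A → B → ℝ} {c : ℝ} (h : ∀ a b, c ≤ Q a b) :
    c ≤ G.stageValue s Q := by
  have := G.stageValue_le_add s (Q := fun _ _ => 0) (Q' := Q) (δ := -c) fun a b => by
    linarith [h a b]
  rw [stageValue_const] at this
  linarith

variable [Fintype S]

/-- The matrix game at `s` whose payoff is the reward over `v` and the value of `h` at the
successor state. -/
noncomputable def stageGame (v : ℝ) (h : S → ℝ) (s : S) (a : A) (b : B) : ℝ :=
  G.reward s a b - v + (G.trans s a b).expect h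

open Classical in
/-- The Bellman operator of the game that is stopped at `z`, with all rewards reduced by `v`. -/
noncomputable def stoppedBellman (z : S) (v : ℝ) (h : S → ℝ) (s : S) : ℝ :=
  if s = z then 0 else G.stageValue s (G.stageGame v (Function.update h z 0) s)

section

variable {G} {z : S} {c : ℝ}
  (hz : ∀ s ≠ z, ∀ a b, c ≤ ((G.trans s a b) z).toReal)

include hz

/-- The operator overwrites its argument by `0` at `z`, so a difference of arguments is felt only
with the mass off `z`, whereas `v` enters each payoff with slope one. -/
theorem dist_stoppedBellman_le (hc1 : c ≤ 1) (v v' : ℝ) (h h' : S → ℝ) :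
    dist (G.stoppedBellman z v h) (G.stoppedBellman z v' h') ≤ |v - v'| + (1 - c) * dist h h' := by
  classical
  have h0 : 0 ≤ (1 - c) * dist h h' := mul_nonneg (by linarith) dist_nonneg
  refine (dist_pi_le_iff (add_nonneg (abs_nonneg _) h0)).2 fun s => ?_
  unfold stoppedBellman
  split_ifs with hs
  · simpa using add_nonneg (abs_nonneg _) h0
  rw [Real.dist_eq]
  refine G.abs_stageValue_sub_le s fun a b => ?_
  have key : ∀ f f' : S → ℝ, (G.trans s a b).expect (Function.update f z 0) -
      (G.trans s a b).expect (Function.update f' z 0) ≤ (1 - c) * dist f f' := fun f f' => by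
    rw [← PMF.expect_sub]
    refine PMF.expect_le_of_vanish _ (z := z) (by simp) (fun t => ?_) dist_nonneg (hz s hs a b)
    by_cases ht : t = z
    · subst ht; simp
    · simpa [ht] using
        (le_abs_self _).trans ((Real.dist_eq _ _).symm.le.trans (dist_le_pi_dist f f' t))
  have h1 := key h h'
  have h2 := key h' h
  rw [dist_comm] at h2
  unfold stageGame
  rw [abs_le]
  constructor <;> linarith [neg_abs_le (v - v'), le_abs_self (v - v')]

/-- Banach's theorem gives the fixed points; the distance `d` of two of them satisfies `d ≤ |v - v'|
+ (1 - c) * d`. -/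
theorem exists_fixedPoint_stoppedBellman (hc : 0 < c) (hc1 : c ≤ 1) :
    ∃ η : ℝ → S → ℝ, (∀ v, G.stoppedBellman z v (η v) = η v) ∧
      ∀ v v', dist (η v) (η v') ≤ |v - v'| / c := by
  have hcontr : ∀ v, ContractingWith (Real.toNNReal (1 - c)) (G.stoppedBellman z v) := fun v =>
    ⟨by simpa using hc, LipschitzWith.of_dist_le_mul fun h h' => by
      simpa [Real.coe_toNNReal (1 - c) (by linarith)] using dist_stoppedBellman_le hz hc1 v v h h'⟩
  have hfix : ∀ v, G.stoppedBellman z v ((hcontr v).fixedPoint _) = (hcontr v).fixedPoint _ :=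
    fun v => (hcontr v).fixedPoint_isFixedPt
  refine ⟨fun v => (hcontr v).fixedPoint _, hfix, fun v v' => ?_⟩
  have h1 := dist_stoppedBellman_le hz hc1 v v' ((hcontr v).fixedPoint _)
    ((hcontr v').fixedPoint _)
  rw [hfix, hfix] at h1
  rw [le_div_iff₀ hc]
  linarith

/-- Maximum principle: the reduced rewards are non-positive, so a positive maximum `h m` would
satisfy `h m ≤ (1 - c) * h m`. -/
theorem fixedPoint_stoppedBellman_nonpos (hc : 0 < c) {v M : ℝ} (hM : ∀ s a b, G.reward s a b ≤ M)
    (hv : M ≤ v)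
    {h : S → ℝ} (hh : G.stoppedBellman z v h = h) (s : S) : h s ≤ 0 := by
  classical
  have : Nonempty S := ⟨z⟩
  obtain ⟨m, hm⟩ := Finite.exists_max h
  refine (hm s).trans ?_
  by_contra! hpos
  have h1 := congrFun hh m
  unfold stoppedBellman at h1
  split_ifs at h1 with hmz
  · linarith
  have h2 : G.stageValue m (G.stageGame v (Function.update h z 0) m) ≤ (1 - c) * h m := by
    refine G.stageValue_le m fun a b => ?_
    have h3 := PMF.expect_le_of_vanish (G.trans m a b) (z := z) (g := Function.update h z 0)
      (by simp) (fun t => ?_) hpos.le (hz m hmz a b)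
    · unfold stageGame
      linarith [hM m a b]
    · by_cases ht : t = z
      · subst ht; simpa using hpos.le
      · simpa [ht] using hm t
  nlinarith

theorem fixedPoint_stoppedBellman_nonneg (hc : 0 < c) {v M : ℝ} (hM : ∀ s a b, M ≤ G.reward s a b)
    (hv : v ≤ M)
    {h : S → ℝ} (hh : G.stoppedBellman z v h = h) (s : S) : 0 ≤ h s := by
  classical
  have : Nonempty S := ⟨z⟩
  obtain ⟨m, hm⟩ := Finite.exists_min h
  refine le_trans ?_ (hm s)
  by_contra! hneg
  have h1 := congrFun hh m
  unfold stoppedBellman at h1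
  split_ifs at h1 with hmz
  · linarith
  have h2 : (1 - c) * h m ≤ G.stageValue m (G.stageGame v (Function.update h z 0) m) := by
    refine G.le_stageValue m fun a b => ?_
    have h3 := PMF.expect_le_of_vanish (G.trans m a b) (z := z)
      (g := fun t => -Function.update h z 0 t) (D := -h m)
      (by simp) (fun t => ?_) (by linarith) (hz m hmz a b)
    · rw [PMF.expect_neg] at h3
      unfold stageGame
      linarith [hM m a b]
    · by_cases ht : t = z
      · subst ht; simpa using hneg.le
      · simpa [ht] using hm t
  nlinarith

/-- The average-reward optimality equation has a solution. -/
theorem exists_optimality_equation (hc : 0 < c) (hc1 : c ≤ 1) :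
    ∃ (v : ℝ) (h : S → ℝ), ∀ s, G.stageValue s (G.stageGame v h s) = h s := by
  classical
  obtain ⟨η, hη, hdist⟩ := exists_fixedPoint_stoppedBellman hz hc hc1
  have hηz : ∀ v, η v z = 0 := fun v => by
    rw [← hη v]
    simp [stoppedBellman]
  obtain ⟨M, hM⟩ := (Set.finite_range fun y : S × A × B => |G.reward y.1 y.2.1 y.2.2|).bddAbove
  have hM : ∀ s a b, |G.reward s a b| ≤ M := fun s a b => hM ⟨(s, a, b), rfl⟩
  have hcont : Continuous fun v => G.stageValue z (G.stageGame v (η v) z) := by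
    refine LipschitzWith.continuous (K := Real.toNNReal (1 + 1 / c))
      (LipschitzWith.of_dist_le_mul fun v v' => ?_)
    rw [Real.dist_eq, Real.dist_eq]
    refine G.abs_stageValue_sub_le z fun a b => ?_
    have key : ∀ f f' : S → ℝ, (G.trans z a b).expect f - (G.trans z a b).expect f' ≤ dist f f' :=
      fun f f' => by
        rw [← PMF.expect_sub, ← (G.trans z a b).expect_const (dist f f')]
        refine PMF.expect_mono _ fun t => ?_
        exact (le_abs_self _).trans ((Real.dist_eq _ _).symm.le.trans (dist_le_pi_dist f f' t))
    have h1 := key (η v) (η v')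
    have h2 := key (η v') (η v)
    rw [dist_comm] at h2
    have h3 := hdist v v'
    rw [Real.coe_toNNReal _ (by positivity), one_add_mul, one_div_mul_eq_div]
    unfold stageGame
    rw [abs_le]
    constructor <;> linarith [neg_abs_le (v - v'), le_abs_self (v - v')]
  -- The stage value at `z` must equal `η v z = 0`. It is at most `0` for `v = M` and at least `0`
  -- for `v = -M`, by the sign of the fixed points there.
  obtain ⟨v, hv⟩ := mem_range_of_exists_le_of_exists_ge (c := (0 : ℝ)) hcont
    ⟨M, G.stageValue_le z fun a b => by
      have := (G.trans z a b).expect_mono (fixedPoint_stoppedBellman_nonpos hz hc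
        (fun s a b => (abs_le.1 (hM s a b)).2) le_rfl (hη M))
      rw [PMF.expect_const] at this
      unfold stageGame
      linarith [(abs_le.1 (hM z a b)).2]⟩
    ⟨-M, G.le_stageValue z fun a b => by
      have := (G.trans z a b).expect_mono (fixedPoint_stoppedBellman_nonneg hz hc
        (fun s a b => (abs_le.1 (hM s a b)).1) le_rfl (hη (-M)))
      rw [PMF.expect_const] at this
      unfold stageGame
      linarith [(abs_le.1 (hM z a b)).1]⟩
  refine ⟨v, η v, fun s => ?_⟩
  by_cases hs : s = z
  · subst hs
    rw [hηz]
    exact hv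
  -- Overwriting `η v` by `0` at `z` changes nothing, so the stopped equation is already the
  -- unstopped one.
  · have h1 := congrFun (hη v) s
    rw [stoppedBellman, if_neg hs, ← hηz v, Function.update_eq_self] at h1
    exact h1

end

end ConcurrentGame

/-! ### Guarantees, values and recurrence -/

namespace ConcurrentGame

variable {S A B : Type*} [Fintype S] [Fintype A] [Fintype B] (G : ConcurrentGame S A B)

theorem expect_round_add_next (σ₁ : G.Strategy₁) (σ₂ : G.Strategy₂) (x : List (S × A × B)) (s : S)
    (v : ℝ) (h : S → ℝ) :
    ((G.round σ₁ σ₂ x s).expect fun y => G.reward y.1 y.2.1 y.2.2 + G.next h y) =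
      v + (σ₁.choice x s).expect fun a => (σ₂.choice x s).expect (G.stageGame v h s a) := by
  have h1 : ∀ a b, G.reward s a b + G.next h (s, a, b) = v + G.stageGame v h s a b :=
    fun a b => by
      rw [stageGame, next]
      ring
  simp only [expect_round, h1]
  simp only [PMF.expect_add, PMF.expect_const]

/-- The stationary strategies that play optimally in the matrix games of the optimality equation. -/
theorem exists_stationary_optimal {v : ℝ} {h : S → ℝ}
    (hh : ∀ s, G.stageValue s (G.stageGame v h s) = h s) :
    ∃ (τ₁ : G.Strategy₁) (τ₂ : G.Strategy₂),
      (∀ σ₂ x s, v + h s ≤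
        (G.round τ₁ σ₂ x s).expect fun y => G.reward y.1 y.2.1 y.2.2 + G.next h y) ∧
      ∀ σ₁ x s,
        ((G.round σ₁ τ₂ x s).expect fun y => G.reward y.1 y.2.1 y.2.2 + G.next h y) ≤ v + h s := by
  choose q₁ q₂ hq₁ hq₂ h1 h2 using fun s => G.stageValue_spec s (G.stageGame v h s)
  refine ⟨⟨fun _ => q₁, fun _ => hq₁⟩, ⟨fun _ => q₂, fun _ => hq₂⟩, fun σ₂ x s => ?_,
    fun σ₁ x s => ?_⟩
  · rw [G.expect_round_add_next _ _ _ _ v, ← hh s]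
    gcongr
    exact h1 s _ (σ₂.support_subset x s)
  · rw [G.expect_round_add_next _ _ _ _ v, ← hh s]
    gcongr
    exact h2 s _ (σ₁.support_subset x s)

theorem exists_abs_avg_le : ∃ M : ℝ, ∀ T ω, |G.avg T ω| ≤ M := by
  obtain ⟨M, hM⟩ := (Set.finite_range fun y : S × A × B => |G.reward y.1 y.2.1 y.2.2|).bddAbove
  -- The maximum with `0` covers `T = 0`, where the average is `0`.
  refine ⟨max M 0, fun T ω => ?_⟩
  rcases T.eq_zero_or_pos with rfl | hT
  · simp [avg]
  have hT' : (0 : ℝ) < T := by exact_mod_cast hT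
  rw [avg, abs_mul, abs_of_nonneg (by positivity), one_div_mul_eq_div, div_le_iff₀ hT']
  calc _ ≤ ∑ i ∈ Finset.range T, |G.reward (ω i).1 (ω i).2.1 (ω i).2.2| :=
        Finset.abs_sum_le_sum_abs _ _
    _ ≤ ∑ _i ∈ Finset.range T, max M 0 :=
        Finset.sum_le_sum fun i _ => (hM ⟨ω i, rfl⟩).trans (le_max_left _ _)
    _ = _ := by simp [mul_comm]

theorem isBoundedUnder_le_avg (ω : ℕ → S × A × B) :
    IsBoundedUnder (· ≤ ·) atTop fun T => G.avg T ω := by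
  obtain ⟨M, hM⟩ := G.exists_abs_avg_le
  exact isBoundedUnder_of ⟨M, fun T => (abs_le.1 (hM T ω)).2⟩

theorem isBoundedUnder_ge_avg (ω : ℕ → S × A × B) :
    IsBoundedUnder (· ≥ ·) atTop fun T => G.avg T ω := by
  obtain ⟨M, hM⟩ := G.exists_abs_avg_le
  exact isBoundedUnder_of ⟨-M, fun T => (abs_le.1 (hM T ω)).1⟩

theorem limInfAvg_le_limSupAvg (ω : ℕ → S × A × B) : G.limInfAvg ω ≤ G.limSupAvg ω :=
  liminf_le_limsup (G.isBoundedUnder_le_avg ω) (G.isBoundedUnder_ge_avg ω)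

theorem exists_bound_limAvg :
    ∃ M : ℝ, ∀ ω, -M ≤ G.limInfAvg ω ∧ G.limSupAvg ω ≤ M := by
  obtain ⟨M, hM⟩ := G.exists_abs_avg_le
  refine ⟨M, fun ω => ⟨?_, ?_⟩⟩
  · exact le_liminf_of_le (G.isBoundedUnder_le_avg ω).isCoboundedUnder_ge
      (.of_forall fun T => (abs_le.1 (hM T ω)).1)
  · exact limsup_le_of_le (G.isBoundedUnder_ge_avg ω).isCoboundedUnder_le
      (.of_forall fun T => (abs_le.1 (hM T ω)).2)

/-- The slack runs through the countable family `1 / (k + 1)`, so that the hypothesis can hold for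
all `k` simultaneously on an almost sure event. -/
theorem le_limInfAvg {v : ℝ} {ω : ℕ → S × A × B}
    (h : ∀ k : ℕ, ∀ᶠ T : ℕ in atTop, (v - 1 / ((k : ℝ) + 1)) * T ≤
      ∑ i ∈ Finset.range T, G.reward (ω i).1 (ω i).2.1 (ω i).2.2) : v ≤ G.limInfAvg ω := by
  refine le_of_forall_pos_lt_add fun ε hε => ?_
  obtain ⟨k, hk⟩ := exists_nat_one_div_lt hε
  have h1 : v - 1 / ((k : ℝ) + 1) ≤ G.limInfAvg ω := by
    refine le_liminf_of_le (G.isBoundedUnder_le_avg ω).isCoboundedUnder_ge ?_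
    filter_upwards [h k, eventually_gt_atTop 0] with T hT hT0
    have hT' : (0 : ℝ) < T := by exact_mod_cast hT0
    rw [avg, one_div_mul_eq_div, le_div_iff₀ hT']
    exact hT
  linarith

theorem limSupAvg_le {v : ℝ} {ω : ℕ → S × A × B}
    (h : ∀ k : ℕ, ∀ᶠ T : ℕ in atTop, (-v - 1 / ((k : ℝ) + 1)) * T ≤
      ∑ i ∈ Finset.range T, -G.reward (ω i).1 (ω i).2.1 (ω i).2.2) : G.limSupAvg ω ≤ v := by
  refine le_of_forall_pos_lt_add fun ε hε => ?_
  obtain ⟨k, hk⟩ := exists_nat_one_div_lt hε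
  have h1 : G.limSupAvg ω ≤ v + 1 / ((k : ℝ) + 1) := by
    refine limsup_le_of_le (G.isBoundedUnder_ge_avg ω).isCoboundedUnder_le ?_
    filter_upwards [h k, eventually_gt_atTop 0] with T hT hT0
    have hT' : (0 : ℝ) < T := by exact_mod_cast hT0
    rw [avg, one_div_mul_eq_div, div_le_iff₀ hT']
    rw [Finset.sum_neg_distrib] at hT
    linarith
  linarith

variable [MeasurableSpace S] [MeasurableSpace A] [MeasurableSpace B]
  [MeasurableSingletonClass S] [MeasurableSingletonClass A] [MeasurableSingletonClass B]

theorem measurable_avg (T : ℕ) : Measurable (G.avg T) := by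
  have hm : Measurable fun y : S × A × B => G.reward y.1 y.2.1 y.2.2 := measurable_of_countable _
  exact (Finset.measurable_sum _ fun i _ => hm.comp (measurable_pi_apply i)).const_mul _

theorem integrable_limInfAvg (P : Measure (ℕ → S × A × B)) [IsProbabilityMeasure P] :
    Integrable G.limInfAvg P := by
  obtain ⟨M, hM⟩ := G.exists_bound_limAvg
  exact .of_bound (Measurable.liminf G.measurable_avg).aestronglyMeasurable M
    (.of_forall fun ω => abs_le.2 ⟨(hM ω).1, (G.limInfAvg_le_limSupAvg ω).trans (hM ω).2⟩)

theorem integrable_limSupAvg (P : Measure (ℕ → S × A × B)) [IsProbabilityMeasure P] :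
    Integrable G.limSupAvg P := by
  obtain ⟨M, hM⟩ := G.exists_bound_limAvg
  exact .of_bound (Measurable.limsup G.measurable_avg).aestronglyMeasurable M
    (.of_forall fun ω => abs_le.2 ⟨(hM ω).1.trans (G.limInfAvg_le_limSupAvg ω), (hM ω).2⟩)

theorem le_integral_limInfAvg {σ₁ : G.Strategy₁} {σ₂ : G.Strategy₂} {v : ℝ} {h : S → ℝ}
    (hh : ∀ x s, v + h s ≤
      (G.round σ₁ σ₂ x s).expect fun y => G.reward y.1 y.2.1 y.2.2 + G.next h y) (s : S) :
    v ≤ ∫ ω, G.limInfAvg ω ∂(G.playMeasure σ₁ σ₂ s) := by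
  have h1 : ∀ᵐ ω ∂(G.playMeasure σ₁ σ₂ s), v ≤ G.limInfAvg ω := by
    filter_upwards [ae_all_iff.2 fun k : ℕ => G.ae_eventually_sum_ge_of_optimality σ₁ σ₂ s hh
      (ε := 1 / ((k : ℝ) + 1)) Nat.one_div_pos_of_nat] with ω hω
    exact G.le_limInfAvg hω
  simpa using integral_mono_ae (integrable_const v) (G.integrable_limInfAvg _) h1

theorem integral_limSupAvg_le {σ₁ : G.Strategy₁} {σ₂ : G.Strategy₂} {v : ℝ} {h : S → ℝ}
    (hh : ∀ x s, ((G.round σ₁ σ₂ x s).expect fun y => G.reward y.1 y.2.1 y.2.2 + G.next h y) ≤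
      v + h s) (s : S) :
    ∫ ω, G.limSupAvg ω ∂(G.playMeasure σ₁ σ₂ s) ≤ v := by
  -- Negating the reward, `h` and `v` turns the upper bound into the lower bound already treated.
  have hh' : ∀ x t, -v + -h t ≤ (G.round σ₁ σ₂ x t).expect fun y =>
      -G.reward y.1 y.2.1 y.2.2 + G.next (fun u => -h u) y := fun x t => by
    have h2 : ∀ y, -G.reward y.1 y.2.1 y.2.2 + G.next (fun u => -h u) y =
        -(G.reward y.1 y.2.1 y.2.2 + G.next h y) := fun y => by
      rw [next, PMF.expect_neg, next]
      ring
    simp only [h2]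
    rw [PMF.expect_neg]
    linarith [hh x t]
  have h1 : ∀ᵐ ω ∂(G.playMeasure σ₁ σ₂ s), G.limSupAvg ω ≤ v := by
    filter_upwards [ae_all_iff.2 fun k : ℕ => G.ae_eventually_sum_ge_of_optimality σ₁ σ₂ s hh'
      (ε := 1 / ((k : ℝ) + 1)) Nat.one_div_pos_of_nat] with ω hω
    exact G.limSupAvg_le hω
  simpa using integral_mono_ae (G.integrable_limSupAvg _) (integrable_const v) h1

/-- A pair of strategies with matching guarantees determines the value. -/
theorem isValue_of_guarantees {s : S} {v : ℝ} {τ₁ : G.Strategy₁} {τ₂ : G.Strategy₂}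
    (h₁ : ∀ σ₂, v ≤ ∫ ω, G.limInfAvg ω ∂(G.playMeasure τ₁ σ₂ s))
    (h₂ : ∀ σ₁, ∫ ω, G.limSupAvg ω ∂(G.playMeasure σ₁ τ₂ s) ≤ v) : G.IsValue s v := by
  have : Nonempty G.Strategy₁ := ⟨τ₁⟩
  have : Nonempty G.Strategy₂ := ⟨τ₂⟩
  obtain ⟨M, hM⟩ := G.exists_bound_limAvg
  have hmono : ∀ σ₁ σ₂, ∫ ω, G.limInfAvg ω ∂(G.playMeasure σ₁ σ₂ s) ≤
      ∫ ω, G.limSupAvg ω ∂(G.playMeasure σ₁ σ₂ s) := fun σ₁ σ₂ =>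
    integral_mono (G.integrable_limInfAvg _) (G.integrable_limSupAvg _) G.limInfAvg_le_limSupAvg
  have hlow : ∀ σ₁ σ₂, -M ≤ ∫ ω, G.limInfAvg ω ∂(G.playMeasure σ₁ σ₂ s) := fun σ₁ σ₂ => by
    simpa using integral_mono (integrable_const (-M)) (G.integrable_limInfAvg
      (G.playMeasure σ₁ σ₂ s)) fun ω => (hM ω).1
  have hupp : ∀ σ₁ σ₂, ∫ ω, G.limSupAvg ω ∂(G.playMeasure σ₁ σ₂ s) ≤ M := fun σ₁ σ₂ => by
    simpa using integral_mono (G.integrable_limSupAvg (G.playMeasure σ₁ σ₂ s))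
      (integrable_const M) fun ω => (hM ω).2
  -- Real infima and suprema of unbounded families take default values, so boundedness is needed
  -- before comparing with them.
  have hinf : ∀ σ₁, BddBelow (Set.range fun σ₂ =>
      ∫ ω, G.limInfAvg ω ∂(G.playMeasure σ₁ σ₂ s)) := fun σ₁ =>
    ⟨-M, by rintro _ ⟨σ₂, rfl⟩; exact hlow σ₁ σ₂⟩
  have hsup : ∀ σ₂, BddAbove (Set.range fun σ₁ =>
      ∫ ω, G.limSupAvg ω ∂(G.playMeasure σ₁ σ₂ s)) := fun σ₂ =>
    ⟨M, by rintro _ ⟨σ₁, rfl⟩; exact hupp σ₁ σ₂⟩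
  have hlv : ∀ σ₁, ⨅ σ₂, ∫ ω, G.limInfAvg ω ∂(G.playMeasure σ₁ σ₂ s) ≤ v := fun σ₁ =>
    (ciInf_le (hinf σ₁) τ₂).trans ((hmono σ₁ τ₂).trans (h₂ σ₁))
  have huv : ∀ σ₂, v ≤ ⨆ σ₁, ∫ ω, G.limSupAvg ω ∂(G.playMeasure σ₁ σ₂ s) := fun σ₂ =>
    ((h₁ σ₂).trans (hmono τ₁ σ₂)).trans (le_ciSup (hsup σ₂) τ₁)
  constructor
  · exact le_antisymm (ciSup_le hlv)
      (le_ciSup_of_le ⟨v, by rintro _ ⟨σ₁, rfl⟩; exact hlv σ₁⟩ τ₁ (le_ciInf h₁))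
  · exact le_antisymm
      (ciInf_le_of_le ⟨v, by rintro _ ⟨σ₂, rfl⟩; exact huv σ₂⟩ τ₂ (ciSup_le h₂)) (le_ciInf huv)

/-- A function `h` with positive drift off `t` shows that `t` is recurrent. -/
theorem ae_frequently_of_drift {t : S} {h : S → ℝ} {δ : ℝ} (hδ : 0 < δ)
    (hh : ∀ s ≠ t, ∀ a b, δ + h s ≤ (G.trans s a b).expect h)
    (ht : ∀ a b, δ + h t ≤ 1 + (G.trans t a b).expect h)
    (σ₁ : G.Strategy₁) (σ₂ : G.Strategy₂) (s : S) :
    ∀ᵐ ω ∂(G.playMeasure σ₁ σ₂ s), ∃ᶠ k in atTop, (ω k).1 = t := by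
  classical
  -- With the indicator of `t` as reward this is an optimality inequality with `v = δ`: visits to
  -- `t` eventually number at least `δ / 2 * T`, which excludes finitely many visits.
  have hh' : ∀ x u, δ + h u ≤ (G.round σ₁ σ₂ x u).expect fun y =>
      (if y.1 = t then (1 : ℝ) else 0) + G.next h y := fun x u => by
    rw [expect_round]
    calc δ + h u = (σ₁.choice x u).expect fun _ => (σ₂.choice x u).expect fun _ => δ + h u := by
          simp only [PMF.expect_const]
      _ ≤ _ := PMF.expect_mono _ fun a => PMF.expect_mono _ fun b => by
          by_cases hu : u = t
          · subst hu; simpa [next] using ht a b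
          · simpa [next, hu] using hh u hu a b
  filter_upwards [G.ae_eventually_sum_ge_of_optimality σ₁ σ₂ s hh' (half_pos hδ)] with ω hω
  intro hev
  obtain ⟨N, hN⟩ := eventually_atTop.1 hev
  have hbd : ∀ T : ℕ, ∑ i ∈ Finset.range T, (if (ω i).1 = t then (1 : ℝ) else 0) ≤ N := by
    intro T
    rw [Finset.sum_boole]
    have : (Finset.range T).filter (fun i => (ω i).1 = t) ⊆ Finset.range N := fun i hi => by
      rw [Finset.mem_range]
      by_contra! hle
      exact hN i hle (Finset.mem_filter.1 hi).2
    exact_mod_cast (Finset.card_le_card this).trans (Finset.card_range N).le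
  obtain ⟨T, hT, hT'⟩ := (hω.and (eventually_gt_atTop ⌈N / (δ / 2)⌉₊)).exists
  have h1 : (N : ℝ) < T * (δ / 2) := (div_lt_iff₀ (half_pos hδ)).1 (Nat.lt_of_ceil_lt hT')
  linarith [hbd T]

end ConcurrentGame

/-! ### Recurrence in the double-spending game -/

namespace DoubleSpending

theorem attackProb_le_half {n : ℕ} (hn : 1 ≤ n) (s : Fin (n + 1)) (a : Fin 4) :
    attackProb n s a ≤ 1 / 2 := by
  have hn' : (0 : ℝ) < n := by exact_mod_cast hn
  have h2 : ((s : ℕ) : ℝ) ≤ n := by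
    have := Nat.lt_succ_iff.1 s.2
    exact_mod_cast this
  have h3 : (((s : ℕ) : ℝ) - 1) * 0.4 / n ≤ 0.4 := by
    rw [div_le_iff₀ hn']; nlinarith
  unfold attackProb successProb
  split_ifs <;> linarith

variable (n : ℕ) (hn : 1 ≤ n) (pdc p f : ℝ) (h0 : 0 < pdc) (h1 : pdc ≤ 1)

theorem trans_toReal (s : Fin (n + 1)) (a : Fin 4) (b : Fin 21) (t : Fin (n + 1)) :
    ((game n hn pdc p f h0 h1).trans s a b t).toReal = transProb n pdc s a t := by
  simp [game, transProb_nonneg hn h0 h1]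

theorem half_le_trans_zero (s : Fin (n + 1)) (hs : s ≠ 0) (a : Fin 4) (b : Fin 21) :
    pdc / 2 ≤ ((game n hn pdc p f h0 h1).trans s a b 0).toReal := by
  rw [trans_toReal, transProb, if_neg hs]
  by_cases hr : Reconnects a
  · rw [if_pos hr, if_pos rfl]
    linarith
  · rw [if_neg hr]
    -- As `n ≥ 1`, a successful attack never leads to `0`; only the failure term `pdc * (1 -
    -- attackProb n s a)` remains, and attacks succeed with probability at most one half.
    have h2 : (0 : Fin (n + 1)) ≠ Fin.last n := fun h => by
      have := congrArg Fin.val h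
      simp at this
      omega
    unfold transSucc transFail
    rw [if_neg h2, if_pos rfl]
    nlinarith [attackProb_le_half hn s a]

theorem ergodic_game : (game n hn pdc p f h0 h1).Ergodic := by
  intro s t σ₁ σ₂
  have hexp : ∀ u a b (h : Fin (n + 1) → ℝ) (v : Fin (n + 1)), (∀ w, 0 ≤ h w) →
      ((game n hn pdc p f h0 h1).trans u a b v).toReal * h v ≤
        ((game n hn pdc p f h0 h1).trans u a b).expect h := fun u a b h v hh =>
    Finset.single_le_sum (f := fun w => ((game n hn pdc p f h0 h1).trans u a b w).toReal * h w)
      (fun w _ => mul_nonneg ENNReal.toReal_nonneg (hh w)) (Finset.mem_univ v)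
  have hn' : (1 : ℝ) ≤ n := by exact_mod_cast hn
  by_cases ht : t = 0
  · subst ht
    have hnn : ∀ w : Fin (n + 1), (0 : ℝ) ≤ if w = 0 then 1 / 2 else 0 := fun w => by
      split_ifs <;> norm_num
    -- Off `0` the drift is at least `(pdc / 2) * (1 / 2) = pdc / 4`; at `0` the unit reward covers
    -- `1 / 2 + pdc / 4`.
    refine ConcurrentGame.ae_frequently_of_drift _ (h := fun u => if u = 0 then 1 / 2 else 0)
      (δ := pdc / 4) (by linarith) (fun u hu a b => ?_) (fun a b => ?_) σ₁ σ₂ s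
    · refine le_trans ?_ (hexp u a b _ 0 hnn)
      have := half_le_trans_zero n hn pdc p f h0 h1 u hu a b
      simp only [if_neg hu, if_true]
      linarith
    · have := (mul_nonneg ENNReal.toReal_nonneg (hnn 0)).trans (hexp 0 a b _ 0 hnn)
      simp only [if_true]
      linarith
  -- The potential is `1` at `t`, `α` at `0` and `0` elsewhere. From `0` the state `t` has
  -- probability `1 / n = 2 * α`, a gain of at least `α`; from any other state, reaching `0` gives
  -- an expected potential of at least `pdc / 2 * α`.
  · set α : ℝ := 1 / (2 * n) with hα
    have hα0 : 0 < α := by positivity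
    have hα1 : 1 / (n : ℝ) = 2 * α := by rw [hα]; field_simp
    have hnn : ∀ w : Fin (n + 1), (0 : ℝ) ≤ if w = 0 then α else if w = t then 1 else 0 :=
      fun w => by split_ifs <;> linarith
    have hδ : pdc / 2 * α ≤ α := by nlinarith
    have hoff : ∀ u ≠ 0, ∀ a b, pdc / 2 * α ≤ ((game n hn pdc p f h0 h1).trans u a b).expect
        fun w => if w = 0 then α else if w = t then 1 else 0 := fun u hu a b => by
      refine le_trans ?_ (hexp u a b _ 0 hnn)
      simp only [if_true]
      exact mul_le_mul_of_nonneg_right (half_le_trans_zero n hn pdc p f h0 h1 u hu a b) hα0.le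
    refine ConcurrentGame.ae_frequently_of_drift _
      (h := fun w => if w = 0 then α else if w = t then 1 else 0)
      (δ := pdc / 2 * α) (by positivity) (fun u hu a b => ?_) (fun a b => ?_) σ₁ σ₂ s
    · by_cases hu0 : u = 0
      · subst hu0
        refine le_trans ?_ (hexp 0 a b _ t hnn)
        rw [trans_toReal, transProb, if_pos rfl, if_neg ht, hα1]
        simp only [if_true, if_neg ht]
        linarith
      · simpa [hu0, hu] using hoff u hu0 a b
    · have := hoff t ht a b
      simp only [if_true, if_neg ht]
      linarith

end DoubleSpending

/-- The double-spending game is ergodic, it has a value `v`, the same at all states, and the seller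
has a strategy which ensures an expected average profit per round of at least `v`, from every
state and against every strategy of the attacker. -/
theorem theorem2 (n : ℕ) (hn : 1 ≤ n) (pdc p f : ℝ) (h0 : 0 < pdc) (h1 : pdc ≤ 1) :
    (DoubleSpending.game n hn pdc p f h0 h1).Ergodic ∧
    ∃ v : ℝ,
      (∀ s, (DoubleSpending.game n hn pdc p f h0 h1).IsValue s v) ∧
      ∃ σ₁ : (DoubleSpending.game n hn pdc p f h0 h1).Strategy₁,
        ∀ (s : Fin (n + 1)) (σ₂ : (DoubleSpending.game n hn pdc p f h0 h1).Strategy₂),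
          Integrable (DoubleSpending.game n hn pdc p f h0 h1).limInfAvg
            ((DoubleSpending.game n hn pdc p f h0 h1).playMeasure σ₁ σ₂ s) ∧
          v ≤ ∫ ω, (DoubleSpending.game n hn pdc p f h0 h1).limInfAvg ω
            ∂((DoubleSpending.game n hn pdc p f h0 h1).playMeasure σ₁ σ₂ s) := by
  refine ⟨DoubleSpending.ergodic_game n hn pdc p f h0 h1, ?_⟩
  -- Here `z = 0` and `c = pdc / 2`.
  obtain ⟨v, h, hh⟩ := ConcurrentGame.exists_optimality_equation
    (DoubleSpending.half_le_trans_zero n hn pdc p f h0 h1) (by linarith) (by linarith)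
  obtain ⟨τ₁, τ₂, hτ₁, hτ₂⟩ := ConcurrentGame.exists_stationary_optimal _ hh
  exact ⟨v, fun s => ConcurrentGame.isValue_of_guarantees _
      (fun σ₂ => ConcurrentGame.le_integral_limInfAvg _ (hτ₁ σ₂) s)
      (fun σ₁ => ConcurrentGame.integral_limSupAvg_le _ (hτ₂ σ₁) s),
    τ₁, fun s σ₂ => ⟨ConcurrentGame.integrable_limInfAvg _ _,
      ConcurrentGame.le_integral_limInfAvg _ (hτ₁ σ₂) s⟩⟩
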